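/- Let $0<T<\infty$, let $(\Omega,\mathcal F,(\mathcal F_t)_{0\le t\le T},\mathbb P)$ be a filtered probability space satisfying the usual conditions, and let $Y=(Y_t)_{0\le t\le T}$ be a real-valued adapted right-continuous process. Let $\mathcal S$ be a compact metric space with metric $d$ and its Borel $\sigma$-algebra, $\mathcal M(\mathcal S)$ the set of Borel probability measures on $\mathcal S$ with the weak topology, $\mathcal P\in\mathcal M(\mathcal S)$, and $(\mathbb P^\theta)_{\theta\in\mathcal S}$ a family of probability measures on $(\Omega,\mathcal F)$ depending measurably on $\theta$, with expectations $\mathbb E^\theta$. For $\mathcal Q\in\mathcal M(\mathcal S)$ let $\mathbb P^{\mathcal Q}(d\theta,d\omega)=\mathcal Q(d\theta)\,\mathbb P^\theta(d\omega)$ on $\mathcal S\times\Omega$. Let $\mathcal T$ be the set of stopping times with values in $[0,T]$. Let $v:\mathbb R\to[-\infty,\infty)$ be proper, concave, nondecreasing and upper semicontinuous, and write $v^{-1}(y)=\sup\{m\in\mathbb R: v(m)\le y\}$. Let $$R(\mathcal Q,s)=\inf_{s'>s}\ \sup\Big\{v^{-1}\Big(\int_{\mathcal S} v(X)\,d\mathcal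 P\Big): X\in C(\mathcal S),\ \int_{\mathcal S} X\,d\mathcal Q\le s'\Big\}\in[-\infty,\infty],\qquad \mathcal Q\in\mathcal M(\mathcal S),\ s\in\mathbb R;$$ this is the unique function $R$ with $v^{-1}(\int v(X)\,d\mathcal P)=\inf_{\mathcal Q\in\mathcal M(\mathcal S)}R(\mathcal Q,\int X\,d\mathcal Q)$ for all $X\in C(\mathcal S)$ that is nondecreasing and right-continuous in $s$, jointly quasi-convex, has a limit as $s\to\infty$ independent of $\mathcal Q$, and for which $\sup_{s'<s}R(\mathcal Q,s')$ is lower semicontinuous in $\mathcal Q$. Put $$G(\tau,\mathcal Q)=R\big(\mathcal Q,\mathbb E^{\mathbb P^{\mathcal Q}}[Y_\tau]\big).$$ Assume: 1. $\mathbb P^\theta\ll\mathbb P$ for all $\theta\in\mathcal S$; let $D^\theta=d\mathbb P^\theta/d\mathbb P$. 2. There is $C<\infty$ with $\mathbb E^\theta[\sup_{0\le t\le T}|Y_t|]<C$ for all $\theta\in\mathcal S$. 3. $\sup_{d(\theta_1,\theta_2)\le h}\mathbb E\big[|D^{\theta_1}-D^{\theta_2}|\sup_{0\le t\le T}|Y_t|\big]\to0$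 as $h\downarrow 0$. 4. Either (i) $R(\mathcal Q,\cdot)$ is continuous on $\mathbb R$ (as an extended-real-valued function) for all $\mathcal Q\in\mathcal M(\mathcal S)$, or (ii) $R(\mathcal Q,\cdot)$ is continuous on $(0,\infty)$ for all $\mathcal Q\in\mathcal M(\mathcal S)$ and $\mathbb E^\theta[Y_\tau]>0$ for all $\tau\in\mathcal T$ and $\theta\in\mathcal S$. Let $\mathbb T=\{t_1,\dots,t_r\}$ with $r\ge1$ and $0<t_1<\dots<t_r=T$, suppose that $(\Omega,\mathcal F_t,\mathbb P|_{\mathcal F_t})$ is atomless for every $t\in\mathbb T$ with $t<T$, and let $\mathcal T_{\mathbb T}$ be the set of stopping times with values in $\mathbb T$. Then $$\sup_{\tau\in\mathcal T_{\mathbb T}}\ \inf_{\mathcal Q\in\mathcal M(\mathcal S)}G(\tau,\mathcal Q)=\inf_{\mathcal Q\in\mathcal M(\mathcal S)}\ \sup_{\tau\in\mathcal T_{\mathbb T}}G(\tau,\mathcal Q).$$ -/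

import Mathlib

open MeasureTheory ProbabilityTheory Filter Topology Set
open scoped ENNReal NNReal

noncomputable section

namespace Ambiguity

/-! ### The ambiguity attitude `v` and its dual function `R` -/

section Dual

variable {S : Type*} [MetricSpace S] [CompactSpace S] [MeasurableSpace S] [BorelSpace S]

/-- `v : ℝ → [-∞, ∞)` is proper, concave (its hypograph is convex), nondecreasing and upper
semicontinuous. -/
structure IsAmbiguityAttitude (v : ℝ → EReal) : Prop where
  ne_top : ∀ x, v x ≠ ⊤
  exists_ne_bot : ∃ x, v x ≠ ⊥
  concave : Convex ℝ {p : ℝ × ℝ | (p.2 : EReal) ≤ v p.1}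
  mono : Monotone v
  usc : UpperSemicontinuous v

/-- `∫ v(X) d𝒫 ∈ [-∞, ∞)`, as the integral of the positive part minus that of the negative part.
For `v` nondecreasing without the value `∞` and `X` continuous on the compact space `S`, the
integral of the positive part is finite. -/
def expectedUtility (v : ℝ → EReal) (P₀ : ProbabilityMeasure S) (X : C(S, ℝ)) : EReal :=
  ((∫⁻ θ, (v (X θ)).toENNReal ∂(P₀ : Measure S) : ℝ≥0∞) : EReal)
    - ((∫⁻ θ, (-(v (X θ))).toENNReal ∂(P₀ : Measure S) : ℝ≥0∞) : EReal)

/-- The certainty equivalent `v⁻¹(∫ v(X) d𝒫)`. Here `v⁻¹(y) = sup {m | v m ≤ y}` is the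
upper semicontinuous generalized inverse of `v`, the inverse of `v` where `v` is strictly
increasing. -/
def certaintyEquivalent (v : ℝ → EReal) (P₀ : ProbabilityMeasure S) (X : C(S, ℝ)) : EReal :=
  ⨆ m : ℝ, ⨆ _ : v m ≤ expectedUtility v P₀ X, (m : EReal)

/-- The dual function `R(𝒬, s)` of the certainty equivalent: the right-continuous version in `s` of
`sup {v⁻¹(∫ v(X) d𝒫) | X ∈ C(S), ∫ X d𝒬 ≤ s}`. By quasi-concave duality between `C(S)` and the
probability measures on `S` with the weak topology, it is the unique function
with `v⁻¹(∫ v(X) d𝒫) = inf_𝒬 R(𝒬, ∫ X d𝒬)` for all `X ∈ C(S)` that is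
nondecreasing and right-continuous in `s`, jointly quasi-convex, has the same limit as `s → ∞` for
all `𝒬`, and has a left-continuous version `sup_{s' < s} R(𝒬, s')` that is lower semicontinuous
in `𝒬`. It takes values in the extended real line. -/
def dualR (v : ℝ → EReal) (P₀ : ProbabilityMeasure S) (Q : ProbabilityMeasure S) (s : ℝ) : EReal :=
  ⨅ s' : ℝ, ⨅ _ : s < s',
    ⨆ X : C(S, ℝ), ⨆ _ : ∫ θ, X θ ∂(Q : Measure S) ≤ s', certaintyEquivalent v P₀ X

end Dual

/-! ### The filtered probability space, the process and the stopping times -/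

section StochasticBasis

variable {Ω : Type*} {mΩ : MeasurableSpace Ω} {T : ℝ}

/-- The usual conditions: the filtration is right-continuous and each `𝓕 t` contains all subsets of
`Ω` that are `μ`-null. -/
structure UsualConditions (𝓕 : Filtration (Icc (0 : ℝ) T) mΩ) (μ : Measure Ω) : Prop where
  rightContinuous : 𝓕.IsRightContinuous
  complete : ∀ t, ∀ A : Set Ω, μ A = 0 → MeasurableSet[𝓕 t] A

/-- The set of stopping times with values in `[0, T]`. -/
def stoppingTimes (𝓕 : Filtration (Icc (0 : ℝ) T) mΩ) : Set (Ω → Icc (0 : ℝ) T) :=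
  {τ | IsStoppingTime 𝓕 (fun ω => (τ ω : WithTop (Icc (0 : ℝ) T)))}

/-- The set of stopping times with values in `𝕋`. -/
def stoppingTimesIn (𝓕 : Filtration (Icc (0 : ℝ) T) mΩ) (𝕋 : Set (Icc (0 : ℝ) T)) :
    Set (Ω → Icc (0 : ℝ) T) :=
  {τ | τ ∈ stoppingTimes 𝓕 ∧ ∀ ω, τ ω ∈ 𝕋}

/-- `sup_{0 ≤ t ≤ T} |Y_t(ω)|`, with values in `[0, ∞]`. -/
def runningSup (Y : Icc (0 : ℝ) T → Ω → ℝ) (ω : Ω) : ℝ≥0∞ := ⨆ t, ‖Y t ω‖ₑ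

/-- `(Ω, m, μ|_m)` has no atoms: each set of `m` of positive probability has a subset in `m` of
strictly smaller positive probability. -/
def Atomless (μ : Measure Ω) (m : MeasurableSpace Ω) : Prop :=
  ∀ A, MeasurableSet[m] A → 0 < μ A → ∃ B ⊆ A, MeasurableSet[m] B ∧ 0 < μ B ∧ μ B < μ A

end StochasticBasis

/-! ### Scenarios and the objective -/

section Scenarios

variable {Ω : Type*} {mΩ : MeasurableSpace Ω} {T : ℝ}
  {S : Type*} [MetricSpace S] [CompactSpace S] [MeasurableSpace S] [BorelSpace S]

/-- `h ↦ sup_{d(θ₁, θ₂) ≤ h} 𝔼[|D^θ₁ - D^θ₂| sup_t |Y_t|]`, with `D^θ` the Radon–Nikodym derivative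
of `ℙ^θ` with respect to `μ`, the reference probability `ℙ`. -/
def densityModulus (μ : Measure Ω) (Pθ : Kernel S Ω) (Y : Icc (0 : ℝ) T → Ω → ℝ) (h : ℝ) : ℝ≥0∞ :=
  ⨆ θ₁ : S, ⨆ θ₂ : S, ⨆ _ : dist θ₁ θ₂ ≤ h,
    ∫⁻ ω, ‖((Pθ θ₁).rnDeriv μ ω).toReal - ((Pθ θ₂).rnDeriv μ ω).toReal‖ₑ * runningSup Y ω ∂μ

/-- The measure `ℙ^𝒬(dθ, dω) = 𝒬(dθ) ℙ^θ(dω)` on `S × Ω`. -/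
def scenarioMeasure (Pθ : Kernel S Ω) (Q : ProbabilityMeasure S) : Measure (S × Ω) :=
  (Q : Measure S) ⊗ₘ Pθ

/-- The objective `G(τ, 𝒬) = R(𝒬, 𝔼^{ℙ^𝒬}[Y_τ])`. -/
def objective (v : ℝ → EReal) (P₀ : ProbabilityMeasure S) (Pθ : Kernel S Ω)
    (Y : Icc (0 : ℝ) T → Ω → ℝ) (τ : Ω → Icc (0 : ℝ) T) (Q : ProbabilityMeasure S) : EReal :=
  dualR v P₀ Q (∫ p, Y (τ p.2) p.2 ∂(scenarioMeasure Pθ Q))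

/-- The alternative continuity assumptions: either `R(𝒬, ·)` is continuous on `ℝ` for all `𝒬`,
or `R(𝒬, ·)` is continuous on `(0, ∞)` for all `𝒬` and `𝔼^θ[Y_τ] > 0` for all stopping times `τ`
and all scenarios `θ`. -/
def ContinuityAssumption (v : ℝ → EReal) (P₀ : ProbabilityMeasure S) (Pθ : Kernel S Ω)
    (𝓕 : Filtration (Icc (0 : ℝ) T) mΩ) (Y : Icc (0 : ℝ) T → Ω → ℝ) : Prop :=
  (∀ Q : ProbabilityMeasure S, Continuous (dualR v P₀ Q)) ∨
  ((∀ Q : ProbabilityMeasure S, ContinuousOn (dualR v P₀ Q) (Ioi 0)) ∧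
    ∀ τ ∈ stoppingTimes 𝓕, ∀ θ : S, 0 < ∫ ω, Y (τ ω) ω ∂(Pθ θ))

end Scenarios

end Ambiguity

end

/-! The inequality sup inf ≤ inf sup is free. The converse rests on one separation argument in
`C(S)`, since a law `𝒬` acts on payoffs `θ ↦ 𝔼^θ[Y_τ]` and on the functions `X` of the dual problem
only through integrals of continuous functions. Below the inf sup, every `𝒬` gives some difference
`f - X` a positive integral, where `f` is a payoff and `X` has a high certainty equivalent. If no
convex combination of such differences were positive everywhere, Hahn–Banach and Riesz would produce
a `𝒬` contradicting this (`exists_mem_convexHull_pos`).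

Two convexifications then have to be undone. For `X` this is done separately for each `𝒬`: an
average of integrals is at least one of them (`exists_mem_integral_le_of_mem_convexHull`). For `f`
it must be done once for all `𝒬`: an atomless `𝓕 (t 0)` simulates randomization between stopping
times, in Lyapunov's manner, at finitely many scenarios at once, and the modulus of the densities
carries this to all of `S` (`convexHull_payoffFunctions_subset`). The error is absorbed by the
positive minimum of `f - X`. -/

namespace Ambiguity

/-! ### Atomless probability spaces -/

section Atomless

variable {Ω : Type*} {mΩ : MeasurableSpace Ω} {μ : Measure Ω}

/-- In an atomless space, a set of positive measure contains sets of arbitrarily small positive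
measure. -/
theorem Atomless.exists_subset_measureReal_le [IsFiniteMeasure μ] (hμ : Atomless μ mΩ)
    {A : Set Ω} (hA : MeasurableSet A) (hA0 : 0 < μ.real A) {ε : ℝ} (hε : 0 < ε) :
    ∃ B ⊆ A, MeasurableSet B ∧ 0 < μ.real B ∧ μ.real B ≤ ε := by
  have halving : ∀ n : ℕ, ∃ B ⊆ A, MeasurableSet B ∧ 0 < μ.real B ∧
      μ.real B ≤ μ.real A * (1 / 2) ^ n := by
    intro n
    induction n with
    | zero => exact ⟨A, Subset.rfl, hA, hA0, by simp⟩
    | succ n ih =>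
      obtain ⟨B, hBA, hB, hB0, hBn⟩ := ih
      obtain ⟨C, hCB, hC, hC0, hCB'⟩ := hμ B hB (ENNReal.toReal_pos_iff.1 hB0).1
      have hC0' : 0 < μ.real C := ENNReal.toReal_pos hC0.ne' (measure_ne_top _ _)
      have hlt : μ.real C < μ.real B :=
        (ENNReal.toReal_lt_toReal (measure_ne_top _ _) (measure_ne_top _ _)).2 hCB'
      have hdiff : μ.real (B \ C) = μ.real B - μ.real C := measureReal_sdiff hCB hC
      rw [pow_succ]
      -- One of `C` and `B \ C` has at most half the measure of `B`.
      by_cases hle : μ.real C ≤ μ.real B / 2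
      · exact ⟨C, hCB.trans hBA, hC, hC0', by linarith⟩
      · exact ⟨B \ C, sdiff_subset.trans hBA, hB.diff hC, by linarith, by linarith⟩
  obtain ⟨n, hn⟩ := exists_pow_lt_of_lt_one (show 0 < ε / μ.real A by positivity)
    (by norm_num : (1 / 2 : ℝ) < 1)
  obtain ⟨B, hBA, hB, hB0, hBn⟩ := halving n
  refine ⟨B, hBA, hB, hB0, hBn.trans ?_⟩
  rw [lt_div_iff₀ hA0] at hn
  linarith

/-- **Sierpiński's theorem**: an atomless finite measure attains all intermediate values. -/
theorem Atomless.exists_subset_measureReal_eq [IsFiniteMeasure μ] (hμ : Atomless μ mΩ)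
    {A : Set Ω} (hA : MeasurableSet A) {c : ℝ} (hc0 : 0 ≤ c) (hcA : c ≤ μ.real A) :
    ∃ B ⊆ A, MeasurableSet B ∧ μ.real B = c := by
  let F : Set (Set Ω) := {B | B ⊆ A ∧ MeasurableSet B ∧ μ.real B ≤ c}
  -- Greedy exhaustion: the next set is within `1 / (n + 1)` of the largest measure reachable from
  -- `B` inside `F`.
  have hstep : ∀ (B : F) (n : ℕ), ∃ B' : F, B.1 ⊆ B'.1 ∧
      ∀ C ∈ F, B.1 ⊆ C → μ.real C ≤ μ.real B'.1 + 1 / (n + 1) := by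
    rintro ⟨B, hB⟩ n
    let V : Set ℝ := {x | ∃ C ∈ F, B ⊆ C ∧ μ.real C = x}
    have hV : V.Nonempty := ⟨_, B, hB, Subset.rfl, rfl⟩
    have hVb : BddAbove V := ⟨c, by rintro _ ⟨C, hC, -, rfl⟩; exact hC.2.2⟩
    obtain ⟨_, ⟨B', hB', hBB', rfl⟩, hlt⟩ := exists_lt_of_lt_csSup hV
      (sub_lt_self (sSup V) (Nat.one_div_pos_of_nat (α := ℝ) (n := n)))
    refine ⟨⟨B', hB'⟩, hBB', fun C hC hBC => ?_⟩
    have := le_csSup hVb ⟨C, hC, hBC, rfl⟩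
    simp only at *
    linarith
  choose next hnext_sub hnext_le using hstep
  let B : ℕ → F := fun n => Nat.rec ⟨∅, empty_subset _, .empty, by simpa using hc0⟩
    (fun n b => next b n) n
  have hBmono : Monotone fun n => (B n).1 := monotone_nat_of_le_succ fun n => hnext_sub (B n) n
  have hUm : MeasurableSet (⋃ n, (B n).1) := .iUnion fun n => (B n).2.2.1
  have hUA : (⋃ n, (B n).1) ⊆ A := iUnion_subset fun n => (B n).2.1
  have hUle : μ.real (⋃ n, (B n).1) ≤ c := by
    refine le_of_tendsto ((ENNReal.tendsto_toReal (measure_ne_top _ _)).comp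
      (tendsto_measure_iUnion_atTop hBmono)) (.of_forall fun n => (B n).2.2.2)
  refine ⟨_, hUA, hUm, hUle.antisymm ?_⟩
  -- If mass is missing, a small set `D` still fits. The enlarged union competes at every stage, so
  -- `μ D ≤ 1 / (n + 1)` for all `n`.
  by_contra! hlt
  have hdiff : μ.real (A \ ⋃ n, (B n).1) = μ.real A - μ.real (⋃ n, (B n).1) :=
    measureReal_sdiff hUA hUm
  obtain ⟨D, hDA, hD, hD0, hDle⟩ := hμ.exists_subset_measureReal_le (hA.diff hUm)
    (by linarith) (sub_pos.2 hlt)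
  have hunion : μ.real ((⋃ n, (B n).1) ∪ D) = μ.real (⋃ n, (B n).1) + μ.real D :=
    measureReal_union (disjoint_left.2 fun x hx hxD => (hDA hxD).2 hx) hD
  have hmem : (⋃ n, (B n).1) ∪ D ∈ F :=
    ⟨union_subset hUA (hDA.trans sdiff_subset), hUm.union hD, by linarith⟩
  obtain ⟨n, hn⟩ := exists_nat_one_div_lt hD0
  have h1 := hnext_le (B n) n _ hmem ((subset_iUnion (fun n => (B n).1) n).trans subset_union_left)
  have h2 : μ.real (next (B n) n).1 ≤ μ.real (⋃ n, (B n).1) :=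
    measureReal_mono (subset_iUnion (fun n => (B n).1) (n + 1))
  linarith

variable {E : Type*} [NormedAddCommGroup E] [NormedSpace ℝ E] [CompleteSpace E]

/-- Sierpiński's theorem cuts the fraction `c` out of each fibre of `g`; the pieces are disjoint. -/
theorem Atomless.exists_setIntegral_simpleFunc_eq [IsFiniteMeasure μ] (hμ : Atomless μ mΩ)
    (g : SimpleFunc Ω E) (hg : Integrable g μ) {c : ℝ} (hc : c ∈ Icc (0 : ℝ) 1) :
    ∃ A, MeasurableSet A ∧ ∫ ω in A, g ω ∂μ = c • ∫ ω, g ω ∂μ := by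
  choose B hBsub hBm hBc using fun y : E => hμ.exists_subset_measureReal_eq
    (g.measurableSet_fiber y) (mul_nonneg hc.1 measureReal_nonneg)
    (mul_le_of_le_one_left measureReal_nonneg hc.2)
  refine ⟨⋃ y ∈ g.range, B y, .biUnion (Finset.countable_toSet _) fun y _ => hBm y, ?_⟩
  rw [integral_biUnion_finset _ (fun y _ => hBm y) _ (fun y _ => hg.integrableOn),
    SimpleFunc.integral_eq_sum _ hg, Finset.smul_sum]
  · refine Finset.sum_congr rfl fun y _ => ?_
    rw [setIntegral_congr_fun (hBm y) (fun ω hω => show g ω = y from hBsub y hω),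
      setIntegral_const, hBc, mul_smul]
  · intro y _ z _ hyz
    exact disjoint_left.2 fun ω hy hz => hyz ((hBsub y hy).symm.trans (hBsub z hz))

/-- Approximate convexity of the range of a vector-valued integral over an atomless space. -/
theorem Atomless.exists_norm_setIntegral_sub_lt [IsFiniteMeasure μ] (hμ : Atomless μ mΩ)
    {g : Ω → E} (hg : Integrable g μ) {c : ℝ} (hc : c ∈ Icc (0 : ℝ) 1) {ε : ℝ} (hε : 0 < ε) :
    ∃ A, MeasurableSet A ∧ ‖∫ ω in A, g ω ∂μ - c • ∫ ω, g ω ∂μ‖ < ε := by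
  obtain ⟨s, hs, hsL⟩ := (memLp_one_iff_integrable.2 hg).exists_simpleFunc_eLpNorm_sub_lt
    ENNReal.one_ne_top (ε := ENNReal.ofReal (ε / 2)) (by simpa using hε)
  have hsi : Integrable s μ := memLp_one_iff_integrable.1 hsL
  have hdi : Integrable (fun ω => g ω - s ω) μ := hg.sub hsi
  have hnorm : ∫ ω, ‖g ω - s ω‖ ∂μ < ε / 2 := by
    rw [integral_norm_eq_lintegral_enorm hdi.1]
    rw [eLpNorm_one_eq_lintegral_enorm] at hs
    exact (ENNReal.lt_ofReal_iff_toReal_lt hs.ne_top).1 hs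
  obtain ⟨A, hA, hAs⟩ := hμ.exists_setIntegral_simpleFunc_eq s hsi hc
  refine ⟨A, hA, ?_⟩
  have h1 : ‖∫ ω in A, (g ω - s ω) ∂μ‖ < ε / 2 :=
    ((norm_integral_le_integral_norm _).trans
      (setIntegral_le_integral hdi.norm (.of_forall fun _ => norm_nonneg _))).trans_lt hnorm
  have h2 : ‖c • ∫ ω, (g ω - s ω) ∂μ‖ < ε / 2 := by
    rw [norm_smul, Real.norm_of_nonneg hc.1]
    exact (mul_le_of_le_one_left (norm_nonneg _) hc.2).trans_lt
      ((norm_integral_le_integral_norm _).trans_lt hnorm)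
  have heq : ∫ ω in A, g ω ∂μ - c • ∫ ω, g ω ∂μ
      = ∫ ω in A, (g ω - s ω) ∂μ - c • ∫ ω, (g ω - s ω) ∂μ := by
    rw [integral_sub hg.integrableOn hsi.integrableOn, integral_sub hg hsi, hAs, smul_sub]
    abel
  rw [heq]
  exact (norm_sub_le _ _).trans_lt (by linarith)

/-- Over a sub-`σ`-algebra without atoms, the integrals of finitely many integrable functions can
be approximately scaled by `c ∈ [0, 1]` through restriction to one of its sets. -/
theorem Atomless.exists_abs_setIntegral_sub_lt [IsFiniteMeasure μ] {m : MeasurableSpace Ω}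
    (hm : m ≤ mΩ) (hμ : Atomless μ m) {ι : Type*} [Fintype ι] {g : ι → Ω → ℝ}
    (hg : ∀ i, Integrable (g i) μ) {c : ℝ} (hc : c ∈ Icc (0 : ℝ) 1) {ε : ℝ} (hε : 0 < ε) :
    ∃ A, MeasurableSet[m] A ∧ ∀ i, |∫ ω in A, g i ω ∂μ - c * ∫ ω, g i ω ∂μ| < ε := by
  let G : Ω → ι → ℝ := fun ω i => g i ω
  have hG : Integrable G μ := Integrable.of_eval hg
  have hμ' : Atomless (μ.trim hm) m := by
    intro A hA hA0
    rw [trim_measurableSet_eq hm hA] at hA0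
    obtain ⟨B, hBA, hB, hB0, hlt⟩ := hμ A hA hA0
    exact ⟨B, hBA, hB, by rwa [trim_measurableSet_eq hm hB],
      by rwa [trim_measurableSet_eq hm hB, trim_measurableSet_eq hm hA]⟩
  -- The conditional expectation of `G` given `m` has the same integrals over sets of `m`, and lives
  -- on the atomless space.
  obtain ⟨A, hA, hlt⟩ := hμ'.exists_norm_setIntegral_sub_lt
    ((integrable_condExp (m := m) (f := G)).trim hm stronglyMeasurable_condExp) hc hε
  refine ⟨A, hA, fun i => ?_⟩
  rw [← setIntegral_trim hm stronglyMeasurable_condExp hA,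
    ← integral_trim hm stronglyMeasurable_condExp, setIntegral_condExp hm hG hA,
    integral_condExp hm] at hlt
  have hi := (norm_le_pi_norm _ i).trans_lt hlt
  rwa [Pi.sub_apply, Pi.smul_apply, eval_integral (fun i => (hg i).integrableOn),
    eval_integral hg, Real.norm_eq_abs, smul_eq_mul] at hi

end Atomless

/-! ### Separation by probability measures -/

section Separation

variable {S : Type*} [MetricSpace S] [CompactSpace S] [MeasurableSpace S] [BorelSpace S]

theorem integrable_continuousMap (Q : ProbabilityMeasure S) (X : C(S, ℝ)) :
    Integrable X (Q : Measure S) :=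
  X.continuous.integrable_of_hasCompactSupport (.of_compactSpace X)

/-- A positive linear functional on `C(S)` is a multiple of the integral against a probability
measure. -/
theorem exists_probabilityMeasure_of_positive [Nonempty S] (Λ : C(S, ℝ) →ₗ[ℝ] ℝ)
    (hpos : ∀ X : C(S, ℝ), 0 ≤ X → 0 ≤ Λ X) :
    ∃ Q : ProbabilityMeasure S, ∀ X : C(S, ℝ), Λ X = Λ 1 * ∫ θ, X θ ∂(Q : Measure S) := by
  let Φ : CompactlySupportedContinuousMap S ℝ →ₚ[ℝ] ℝ := PositiveLinearMap.mk₀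
    { toFun := fun f => Λ f.toContinuousMap
      map_add' := fun f g => Λ.map_add f.toContinuousMap g.toContinuousMap
      map_smul' := fun c f => Λ.map_smul c f.toContinuousMap }
    (fun f hf => hpos _ hf)
  let ν := RealRMK.rieszMeasure Φ
  have hν : ∀ X : C(S, ℝ), ∫ θ, X θ ∂ν = Λ X := fun X =>
    RealRMK.integral_rieszMeasure Φ (CompactlySupportedContinuousMap.continuousMapEquiv X)
  have hfin : IsFiniteMeasure ν := inferInstanceAs (IsFiniteMeasure (RealRMK.rieszMeasure Φ))
  have hmass : ν.real univ = Λ 1 := by simpa using hν 1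
  by_cases h0 : ν.real univ = 0
  · have hν0 : ν = 0 := by simpa [Measure.real, ENNReal.toReal_eq_zero_iff] using h0
    refine ⟨⟨Measure.dirac (Classical.arbitrary S), inferInstance⟩, fun X => ?_⟩
    rw [← hν X, ← hmass, h0, hν0]
    simp
  · have : NeZero ν := ⟨by rintro h; exact h0 (by simp [h])⟩
    refine ⟨⟨(ν univ)⁻¹ • ν, inferInstance⟩, fun X => ?_⟩
    have : ∫ θ, X θ ∂((ν univ)⁻¹ • ν) = (ν.real univ)⁻¹ * ∫ θ, X θ ∂ν := by
      rw [integral_smul_measure, ENNReal.toReal_inv, smul_eq_mul, Measure.real]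
    change Λ X = Λ 1 * ∫ θ, X θ ∂((ν univ)⁻¹ • ν)
    rw [this, ← hmass, hν, mul_inv_cancel_left₀ h0]

/-- If every probability measure integrates some function of `B` to a positive number, then some
convex combination of functions in `B` is positive everywhere. -/
theorem exists_mem_convexHull_pos [Nonempty S] {B : Set C(S, ℝ)}
    (hB : ∀ Q : ProbabilityMeasure S, ∃ X ∈ B, 0 < ∫ θ, X θ ∂(Q : Measure S)) :
    ∃ X ∈ convexHull ℝ B, ∀ θ, 0 < X θ := by
  by_contra! hcon
  have hconv : Convex ℝ {X : C(S, ℝ) | ∀ θ, 0 < X θ} := by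
    intro X hX Z hZ a b ha hb hab θ
    simp only [ContinuousMap.add_apply, ContinuousMap.smul_apply, smul_eq_mul]
    rcases ha.eq_or_lt with rfl | ha
    · obtain rfl : b = 1 := by linarith
      simpa using hZ θ
    · have := mul_pos ha (hX θ)
      have := mul_nonneg hb (hZ θ).le
      linarith
  have hopen : IsOpen {X : C(S, ℝ) | ∀ θ, 0 < X θ} := by
    simpa [MapsTo] using ContinuousMap.isOpen_setOfPred_mapsTo (X := S) (Y := ℝ) isCompact_univ
      (isOpen_Ioi (a := 0))
  obtain ⟨L, u, hL, hu⟩ := geometric_hahn_banach_open hconv hopen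
    (convex_convexHull ℝ B) (disjoint_left.2 fun X hX hXB => by
      obtain ⟨θ, hθ⟩ := hcon X hXB
      exact (hX θ).not_ge hθ)
  -- The positive functions form a cone, so the bound `u` forces `L ≤ 0` there: otherwise `L (n • X
  -- + 1)` exceeds `u` for large `n`. Shrinking `1` to `0` gives `0 ≤ u`.
  have hbound : ∀ X : C(S, ℝ), 0 ≤ X → L X ≤ 0 := by
    intro X hX
    by_contra! hpos
    obtain ⟨n, hn⟩ := exists_nat_gt ((u - L 1) / L X)
    rw [div_lt_iff₀ hpos] at hn
    have := hL ((n : ℝ) • X + 1) fun θ => by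
      have : 0 ≤ X θ := hX θ
      simp only [ContinuousMap.add_apply, ContinuousMap.smul_apply, smul_eq_mul,
        ContinuousMap.one_apply]
      positivity
    simp only [map_add, map_smul, smul_eq_mul] at this
    linarith
  have hu0 : 0 ≤ u := by
    have hlim : Tendsto (fun n : ℕ => (1 / ((n : ℝ) + 1)) * L 1) atTop (𝓝 (0 * L 1)) :=
      tendsto_one_div_add_atTop_nhds_zero_nat.mul_const _
    rw [zero_mul] at hlim
    refine le_of_tendsto hlim (.of_forall fun n => ?_)
    have := hL ((1 / ((n : ℝ) + 1)) • 1) fun θ => by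
      simp only [ContinuousMap.smul_apply, smul_eq_mul, ContinuousMap.one_apply]
      positivity
    simpa using this.le
  obtain ⟨Q, hQ⟩ := exists_probabilityMeasure_of_positive (-(L : C(S, ℝ) →ₗ[ℝ] ℝ))
    fun X hX => by simpa using hbound X hX
  have hQ' : ∀ X : C(S, ℝ), L X = L 1 * ∫ θ, X θ ∂(Q : Measure S) := fun X => by
    simpa using hQ X
  obtain ⟨X, hXB, hX⟩ := hB Q
  have hXu := hu X (subset_convexHull ℝ B hXB)
  have h1 := hL 1 fun θ => by simp
  have h1' : L 1 ≤ 0 := hbound 1 fun θ => by simp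
  rw [hQ' X] at hXu
  rcases h1'.eq_or_lt with h | h
  · rw [h, zero_mul] at hXu
    linarith
  · have := mul_neg_of_neg_of_pos h hX
    linarith

open scoped Pointwise in
theorem exists_mem_convexHull_forall_lt [Nonempty S] {K A : Set C(S, ℝ)}
    (h : ∀ Q : ProbabilityMeasure S, ∃ f ∈ K, ∃ X ∈ A,
      ∫ θ, X θ ∂(Q : Measure S) < ∫ θ, f θ ∂(Q : Measure S)) :
    ∃ f ∈ convexHull ℝ K, ∃ X ∈ convexHull ℝ A, ∀ θ, X θ < f θ := by
  obtain ⟨g, hg, hgpos⟩ := exists_mem_convexHull_pos (B := K - A) fun Q => by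
    obtain ⟨f, hf, X, hX, hlt⟩ := h Q
    refine ⟨f - X, Set.sub_mem_sub hf hX, ?_⟩
    simp only [ContinuousMap.sub_apply]
    rw [integral_sub (integrable_continuousMap Q f) (integrable_continuousMap Q X)]
    exact sub_pos.2 hlt
  rw [convexHull_sub] at hg
  obtain ⟨f, hf, X, hX, rfl⟩ := hg
  exact ⟨f, hf, X, hX, fun θ => by simpa using hgpos θ⟩

/-- Otherwise `A`, and with it its convex hull, would lie in an open half-space that excludes `X`.
This stands in for quasi-concavity of the certainty equivalent; `Z` may depend on `Q`. -/
theorem exists_mem_integral_le_of_mem_convexHull {A : Set C(S, ℝ)} {X : C(S, ℝ)}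
    (hX : X ∈ convexHull ℝ A) (Q : ProbabilityMeasure S) :
    ∃ Z ∈ A, ∫ θ, Z θ ∂(Q : Measure S) ≤ ∫ θ, X θ ∂(Q : Measure S) := by
  by_contra! hcon
  have hconv : Convex ℝ {Z : C(S, ℝ) | ∫ θ, X θ ∂(Q : Measure S) < ∫ θ, Z θ ∂(Q : Measure S)} :=
    convex_halfSpace_gt ⟨fun Z W => by
      simpa using integral_add (integrable_continuousMap Q Z) (integrable_continuousMap Q W),
      fun c Z => by simpa using integral_const_mul c Z⟩ _
  exact lt_irrefl (∫ θ, X θ ∂(Q : Measure S))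
    (convexHull_min (fun Z hZ => hcon Z hZ) hconv hX)

theorem integral_lt_integral_of_forall_lt (Q : ProbabilityMeasure S) {X Z : C(S, ℝ)}
    (h : ∀ θ, X θ < Z θ) : ∫ θ, X θ ∂(Q : Measure S) < ∫ θ, Z θ ∂(Q : Measure S) := by
  rw [← sub_pos, ← integral_sub (integrable_continuousMap Q Z) (integrable_continuousMap Q X)]
  refine (integral_pos_iff_support_of_nonneg (fun θ => (sub_pos.2 (h θ)).le)
    ((integrable_continuousMap Q Z).sub (integrable_continuousMap Q X))).2 ?_
  have : Function.support (fun θ => Z θ - X θ) = univ :=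
    eq_univ_of_forall fun θ => (sub_pos.2 (h θ)).ne'
  rw [this]
  simp

end Separation

/-! ### The dual function -/

section Dual

variable {S : Type*} [MetricSpace S] [MeasurableSpace S]
  {v : ℝ → EReal} {P₀ Q : ProbabilityMeasure S}

theorem certaintyEquivalent_le_dualR {X : C(S, ℝ)} {s : ℝ}
    (h : ∫ θ, X θ ∂(Q : Measure S) ≤ s) : certaintyEquivalent v P₀ X ≤ dualR v P₀ Q s :=
  le_iInf₂ fun _ hs' => le_iSup₂_of_le X (h.trans hs'.le) le_rfl

/-- Where `dualR v P₀ Q` is left-continuous, its strict superlevel sets are witnessed by elements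
of the budget set. -/
theorem exists_lt_certaintyEquivalent {s : ℝ} {a : EReal}
    (hs : ContinuousAt (dualR v P₀ Q) s) (ha : a < dualR v P₀ Q s) :
    ∃ X : C(S, ℝ), a < certaintyEquivalent v P₀ X ∧ ∫ θ, X θ ∂(Q : Measure S) < s := by
  -- Moving left to `s₁ < s` leaves room for a budget `s₂` strictly between, at which the infimum
  -- defining `dualR v P₀ Q s₁` can be evaluated.
  have hev : ∀ᶠ s₁ in 𝓝[<] s, a < dualR v P₀ Q s₁ :=
    nhdsWithin_le_nhds (hs.eventually_const_lt ha)
  obtain ⟨s₁, h₁, hs₁⟩ := (hev.and self_mem_nhdsWithin).exists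
  obtain ⟨s₂, h₁₂, h₂⟩ := exists_between (show s₁ < s from hs₁)
  have hlt := h₁.trans_le (iInf₂_le s₂ h₁₂)
  simp only [lt_iSup_iff] at hlt
  obtain ⟨X, hX, haX⟩ := hlt
  exact ⟨X, haX, hX.trans_lt h₂⟩

end Dual

/-! ### Expected payoffs of stopping times with finitely many values -/

section Payoff

variable {Ω : Type*} {mΩ : MeasurableSpace Ω} {T : ℝ}

theorem measurable_stopped {ι : Type*} [Countable ι] {𝓕 : Filtration (Icc (0 : ℝ) T) mΩ}
    {Y : Icc (0 : ℝ) T → Ω → ℝ} (hY : Adapted 𝓕 Y) {t : ι → Icc (0 : ℝ) T}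
    {τ : Ω → Icc (0 : ℝ) T} (hτ : τ ∈ stoppingTimesIn 𝓕 (range t)) :
    Measurable fun ω => Y (τ ω) ω := by
  intro B hB
  have hpre : (fun ω => Y (τ ω) ω) ⁻¹' B = ⋃ i, {ω | τ ω = t i} ∩ Y (t i) ⁻¹' B := by
    ext ω
    simp only [mem_preimage, mem_iUnion, mem_inter_iff, mem_ofPred_eq]
    refine ⟨fun h => ?_, fun ⟨i, hi, h⟩ => by rwa [hi]⟩
    obtain ⟨i, hi⟩ := hτ.2 ω
    exact ⟨i, hi.symm, by rwa [hi]⟩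
  rw [hpre]
  refine .iUnion fun i => .inter ?_ ((hY (t i)).mono (𝓕.le _) le_rfl hB)
  have := hτ.1.measurableSet_eq (t i)
  simp only [WithTop.coe_eq_coe] at this
  exact 𝓕.le _ _ this

open Classical in
/-- Two stopping times with values in `[s, ∞)` may be pasted along an event known at time `s`. -/
theorem piecewise_mem_stoppingTimesIn {𝓕 : Filtration (Icc (0 : ℝ) T) mΩ}
    {𝕋 : Set (Icc (0 : ℝ) T)} {s : Icc (0 : ℝ) T} (hs : ∀ u ∈ 𝕋, s ≤ u)
    {τ₁ τ₂ : Ω → Icc (0 : ℝ) T} (h₁ : τ₁ ∈ stoppingTimesIn 𝓕 𝕋)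
    (h₂ : τ₂ ∈ stoppingTimesIn 𝓕 𝕋) {A : Set Ω} (hA : MeasurableSet[𝓕 s] A) :
    A.piecewise τ₁ τ₂ ∈ stoppingTimesIn 𝓕 𝕋 := by
  have hmem : ∀ ω, A.piecewise τ₁ τ₂ ω ∈ 𝕋 := fun ω => by
    by_cases hω : ω ∈ A
    · simpa [hω] using h₁.2 ω
    · simpa [hω] using h₂.2 ω
  refine ⟨fun u => ?_, hmem⟩
  by_cases hsu : s ≤ u
  · have hA' : MeasurableSet[𝓕 u] A := 𝓕.mono hsu _ hA
    have heq : {ω | ((A.piecewise τ₁ τ₂ ω : Icc (0 : ℝ) T) : WithTop (Icc (0 : ℝ) T)) ≤ u}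
        = A.ite {ω | (τ₁ ω : WithTop (Icc (0 : ℝ) T)) ≤ u}
          {ω | (τ₂ ω : WithTop (Icc (0 : ℝ) T)) ≤ u} := by
      ext ω
      by_cases hω : ω ∈ A <;> simp [Set.ite, hω]
    rw [heq]
    exact hA'.ite (h₁.1 u) (h₂.1 u)
  -- Before time `s` neither rule has stopped.
  · convert @MeasurableSet.empty _ (𝓕 u)
    refine eq_empty_of_forall_notMem fun ω hω => hsu ((hs _ (hmem ω)).trans ?_)
    exact WithTop.coe_le_coe.1 hω

theorem enorm_stopped_le_runningSup (Y : Icc (0 : ℝ) T → Ω → ℝ) (τ : Ω → Icc (0 : ℝ) T) (ω : Ω) :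
    ‖Y (τ ω) ω‖ₑ ≤ runningSup Y ω :=
  le_iSup (fun t => ‖Y t ω‖ₑ) (τ ω)

theorem integral_scenarioMeasure {S : Type*} [MeasurableSpace S] {Pθ : Kernel S Ω}
    [IsMarkovKernel Pθ] {Y : Icc (0 : ℝ) T → Ω → ℝ} {Z : Ω → ℝ} (hZ : Measurable Z)
    (hZY : ∀ ω, ‖Z ω‖ₑ ≤ runningSup Y ω)
    {C : ℝ≥0} (hC : ∀ θ, ∫⁻ ω, runningSup Y ω ∂(Pθ θ) < C) (Q : ProbabilityMeasure S) :
    ∫ p, Z p.2 ∂(scenarioMeasure Pθ Q) = ∫ θ, ∫ ω, Z ω ∂(Pθ θ) ∂(Q : Measure S) := by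
  refine Measure.integral_compProd ⟨(hZ.comp measurable_snd).aestronglyMeasurable, ?_⟩
  rw [HasFiniteIntegral, Measure.lintegral_compProd (by fun_prop)]
  calc ∫⁻ θ, ∫⁻ ω, ‖Z ω‖ₑ ∂(Pθ θ) ∂(Q : Measure S) ≤ ∫⁻ _, C ∂(Q : Measure S) :=
        lintegral_mono fun θ => (lintegral_mono hZY).trans (hC θ).le
    _ < ∞ := by simp

variable {S : Type*} [MetricSpace S] [MeasurableSpace S]
  {μ : Measure Ω} [IsProbabilityMeasure μ] {Pθ : Kernel S Ω} [IsMarkovKernel Pθ]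
  {Y : Icc (0 : ℝ) T → Ω → ℝ} {Z : Ω → ℝ}

theorem integrable_of_enorm_le_runningSup (hZ : Measurable Z)
    (hZY : ∀ ω, ‖Z ω‖ₑ ≤ runningSup Y ω) {ν : Measure Ω} {C : ℝ≥0}
    (hC : ∫⁻ ω, runningSup Y ω ∂ν < C) : Integrable Z ν :=
  ⟨hZ.aestronglyMeasurable, (lintegral_mono hZY).trans_lt (hC.trans ENNReal.coe_lt_top)⟩

theorem enorm_integral_sub_integral_le_densityModulus (habs : ∀ θ, Pθ θ ≪ μ)
    (hZi : ∀ θ, Integrable Z (Pθ θ)) (hZY : ∀ ω, ‖Z ω‖ₑ ≤ runningSup Y ω)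
    {θ₁ θ₂ : S} {h : ℝ} (hθ : dist θ₁ θ₂ ≤ h) :
    ‖∫ ω, Z ω ∂(Pθ θ₁) - ∫ ω, Z ω ∂(Pθ θ₂)‖ₑ ≤ densityModulus μ Pθ Y h := by
  rw [← integral_rnDeriv_smul (habs θ₁), ← integral_rnDeriv_smul (habs θ₂),
    ← integral_sub ((integrable_rnDeriv_smul_iff (habs θ₁)).2 (hZi θ₁))
      ((integrable_rnDeriv_smul_iff (habs θ₂)).2 (hZi θ₂))]
  refine (enorm_integral_le_lintegral_enorm _).trans ((lintegral_mono fun ω => ?_).trans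
    (le_iSup_of_le θ₁ (le_iSup₂_of_le θ₂ hθ le_rfl)))
  rw [← sub_smul, enorm_smul]
  exact mul_le_mul_right (hZY ω) _

/-- Equicontinuity: `h` is chosen before `Z`, so it also serves stopping times built later from a
net of mesh `h`. -/
theorem exists_forall_abs_integral_sub_lt
    (habs : ∀ θ, Pθ θ ≪ μ) (hdens : Tendsto (densityModulus μ Pθ Y) (𝓝[>] 0) (𝓝 0))
    {ε : ℝ} (hε : 0 < ε) :
    ∃ h > 0, ∀ Z : Ω → ℝ, (∀ θ, Integrable Z (Pθ θ)) → (∀ ω, ‖Z ω‖ₑ ≤ runningSup Y ω) →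
      ∀ θ₁ θ₂, dist θ₁ θ₂ ≤ h → |∫ ω, Z ω ∂(Pθ θ₁) - ∫ ω, Z ω ∂(Pθ θ₂)| < ε := by
  obtain ⟨h, hlt, hh⟩ := ((hdens.eventually_lt_const (ENNReal.ofReal_pos.2 hε)).and
    self_mem_nhdsWithin).exists
  refine ⟨h, hh, fun Z hZi hZY θ₁ θ₂ hθ => ?_⟩
  have := (enorm_integral_sub_integral_le_densityModulus habs hZi hZY hθ).trans_lt hlt
  rw [Real.enorm_eq_ofReal_abs] at this
  exact (ENNReal.ofReal_lt_ofReal_iff hε).1 this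

theorem continuous_integral_kernel
    (habs : ∀ θ, Pθ θ ≪ μ) (hdens : Tendsto (densityModulus μ Pθ Y) (𝓝[>] 0) (𝓝 0))
    (hZi : ∀ θ, Integrable Z (Pθ θ)) (hZY : ∀ ω, ‖Z ω‖ₑ ≤ runningSup Y ω) :
    Continuous fun θ => ∫ ω, Z ω ∂(Pθ θ) := by
  refine Metric.continuous_iff.2 fun θ ε hε => ?_
  obtain ⟨h, hh, H⟩ := exists_forall_abs_integral_sub_lt habs hdens hε
  exact ⟨h, hh, fun θ' hθ' => H Z hZi hZY _ _ hθ'.le⟩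

end Payoff

/-! ### Approximate convexity of the set of payoff functions -/

section PayoffFunctions

variable {Ω : Type*} {mΩ : MeasurableSpace Ω} {T : ℝ} {S : Type*} [MetricSpace S]
  [CompactSpace S] [MeasurableSpace S]

/-- The functions `θ ↦ 𝔼^θ[Y_τ]` for stopping times `τ` with values in `𝕋`. -/
def payoffFunctions (𝓕 : Filtration (Icc (0 : ℝ) T) mΩ) (Y : Icc (0 : ℝ) T → Ω → ℝ)
    (Pθ : Kernel S Ω) (𝕋 : Set (Icc (0 : ℝ) T)) : Set C(S, ℝ) :=
  {f | ∃ τ ∈ stoppingTimesIn 𝓕 𝕋, ∀ θ, f θ = ∫ ω, Y (τ ω) ω ∂(Pθ θ)}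

variable {μ : Measure Ω} [IsProbabilityMeasure μ] {𝓕 : Filtration (Icc (0 : ℝ) T) mΩ}
  {Y : Icc (0 : ℝ) T → Ω → ℝ} {Pθ : Kernel S Ω} [IsMarkovKernel Pθ] {C : ℝ≥0}
  {r : ℕ} {t : Fin (r + 1) → Icc (0 : ℝ) T}

open Classical in
/-- Pasting two stopping times along a suitable event of `𝓕 (t 0)` approximates, uniformly in the
scenarios, the randomization between them. -/
theorem add_smul_mem_closure_payoffFunctions (hY : Adapted 𝓕 Y) (habs : ∀ θ, Pθ θ ≪ μ)
    (hC : ∀ θ, ∫⁻ ω, runningSup Y ω ∂(Pθ θ) < C)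
    (hdens : Tendsto (densityModulus μ Pθ Y) (𝓝[>] 0) (𝓝 0)) (ht : StrictMono t)
    (hatom : Atomless μ (𝓕 (t 0))) {f₁ f₂ : C(S, ℝ)}
    (hf₁ : f₁ ∈ payoffFunctions 𝓕 Y Pθ (range t)) (hf₂ : f₂ ∈ payoffFunctions 𝓕 Y Pθ (range t))
    {a b : ℝ} (ha : 0 ≤ a) (hb : 0 ≤ b) (hab : a + b = 1) :
    a • f₁ + b • f₂ ∈ closure (payoffFunctions 𝓕 Y Pθ (range t)) := by
  obtain ⟨τ₁, hτ₁, hf₁⟩ := hf₁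
  obtain ⟨τ₂, hτ₂, hf₂⟩ := hf₂
  have hint : ∀ τ ∈ stoppingTimesIn 𝓕 (range t), ∀ θ, Integrable (fun ω => Y (τ ω) ω) (Pθ θ) :=
    fun τ hτ θ => integrable_of_enorm_le_runningSup (measurable_stopped hY hτ)
      (enorm_stopped_le_runningSup Y τ) (hC θ)
  refine Metric.mem_closure_iff.2 fun ε hε => ?_
  obtain ⟨h, hh, H⟩ := exists_forall_abs_integral_sub_lt habs hdens (show 0 < ε / 4 by positivity)
  obtain ⟨N, -, hNfin, hN⟩ := finite_cover_balls_of_compact (isCompact_univ (X := S)) hh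
  have := hNfin.fintype
  -- Under `μ`, the integral of `g i` over `A` is the gain in scenario `i` from using `τ₁` rather
  -- than `τ₂` on `A`.
  let g : N → Ω → ℝ := fun i ω =>
    ((Pθ i).rnDeriv μ ω).toReal • (Y (τ₁ ω) ω - Y (τ₂ ω) ω)
  have hg : ∀ i, Integrable (g i) μ := fun i =>
    (integrable_rnDeriv_smul_iff (habs i)).2 ((hint τ₁ hτ₁ i).sub (hint τ₂ hτ₂ i))
  obtain ⟨A, hA, hAg⟩ := hatom.exists_abs_setIntegral_sub_lt (𝓕.le _) hg (c := a)
    ⟨ha, by linarith⟩ (show 0 < ε / 4 by positivity)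
  have hAm : MeasurableSet A := 𝓕.le _ _ hA
  have hτ : A.piecewise τ₁ τ₂ ∈ stoppingTimesIn 𝓕 (range t) :=
    piecewise_mem_stoppingTimesIn (by rintro _ ⟨i, rfl⟩; exact ht.monotone (Fin.zero_le i))
      hτ₁ hτ₂ hA
  let f : C(S, ℝ) := ⟨fun θ => ∫ ω, Y (A.piecewise τ₁ τ₂ ω) ω ∂(Pθ θ),
    continuous_integral_kernel habs hdens (hint _ hτ) (enorm_stopped_le_runningSup Y _)⟩
  refine ⟨f, ⟨_, hτ, fun θ => rfl⟩, (ContinuousMap.dist_lt_iff hε).2 fun θ => ?_⟩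
  obtain ⟨i, hiN, hi⟩ : ∃ i ∈ N, dist θ i < h := by simpa using hN (mem_univ θ)
  have hfi : f i = (∫ ω in A, g ⟨i, hiN⟩ ω ∂μ) + f₂ i := by
    have hpw : (fun ω => Y (A.piecewise τ₁ τ₂ ω) ω)
        = fun ω => A.indicator (fun ω => Y (τ₁ ω) ω - Y (τ₂ ω) ω) ω + Y (τ₂ ω) ω := by
      ext ω
      by_cases hω : ω ∈ A <;> simp [hω]
    have hdiff : Integrable (fun ω => Y (τ₁ ω) ω - Y (τ₂ ω) ω) (Pθ i) :=
      (hint τ₁ hτ₁ i).sub (hint τ₂ hτ₂ i)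
    have hind : ∫ ω in A, g ⟨i, hiN⟩ ω ∂μ
        = ∫ ω, A.indicator (fun ω => Y (τ₁ ω) ω - Y (τ₂ ω) ω) ω ∂(Pθ i) := by
      rw [← integral_rnDeriv_smul (habs i), ← integral_indicator hAm]
      refine integral_congr_ae (.of_forall fun ω => ?_)
      by_cases hω : ω ∈ A <;> simp [g, hω]
    rw [hind, hf₂, ← integral_add (hdiff.indicator hAm) (hint τ₂ hτ₂ i), ← hpw]
    rfl
  have hgi : ∫ ω, g ⟨i, hiN⟩ ω ∂μ = f₁ i - f₂ i := by
    rw [hf₁, hf₂, ← integral_sub (hint τ₁ hτ₁ i) (hint τ₂ hτ₂ i)]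
    exact integral_rnDeriv_smul (habs i)
  have hA' := hAg ⟨i, hiN⟩
  rw [hgi] at hA'
  have hd : |f θ - f i| < ε / 4 :=
    H _ (hint _ hτ) (enorm_stopped_le_runningSup Y _) _ _ hi.le
  have hd₁ : |f₁ θ - f₁ i| < ε / 4 := by
    rw [hf₁, hf₁]
    exact H _ (hint _ hτ₁) (enorm_stopped_le_runningSup Y _) _ _ hi.le
  have hd₂ : |f₂ θ - f₂ i| < ε / 4 := by
    rw [hf₂, hf₂]
    exact H _ (hint _ hτ₂) (enorm_stopped_le_runningSup Y _) _ _ hi.le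
  have hd₃ : |a * (f₁ θ - f₁ i) + b * (f₂ θ - f₂ i)| ≤ ε / 4 := by
    refine (abs_add_le _ _).trans ?_
    rw [abs_mul, abs_mul, abs_of_nonneg ha, abs_of_nonneg hb]
    calc a * |f₁ θ - f₁ i| + b * |f₂ θ - f₂ i| ≤ a * (ε / 4) + b * (ε / 4) := by gcongr
      _ = ε / 4 := by rw [← add_mul, hab, one_mul]
  -- Three errors below or equal to `ε / 4`: moving the mixture from `θ` to the net point `i`,
  -- moving `f`, and the splitting error at `i`.
  have hsplit : a * f₁ θ + b * f₂ θ - f θ = (a * (f₁ θ - f₁ i) + b * (f₂ θ - f₂ i))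
      - (f θ - f i) - (∫ ω in A, g ⟨i, hiN⟩ ω ∂μ - a * (f₁ i - f₂ i)) := by
    rw [hfi, show b = 1 - a by linarith]
    ring
  rw [Real.dist_eq, ContinuousMap.add_apply, ContinuousMap.smul_apply, ContinuousMap.smul_apply,
    smul_eq_mul, smul_eq_mul, hsplit]
  rw [abs_lt] at hA' hd ⊢
  rw [abs_le] at hd₃
  constructor <;> linarith

theorem convexHull_payoffFunctions_subset (hY : Adapted 𝓕 Y) (habs : ∀ θ, Pθ θ ≪ μ)
    (hC : ∀ θ, ∫⁻ ω, runningSup Y ω ∂(Pθ θ) < C)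
    (hdens : Tendsto (densityModulus μ Pθ Y) (𝓝[>] 0) (𝓝 0)) (ht : StrictMono t)
    (htT : (t (Fin.last r) : ℝ) = T)
    (hatom : ∀ i, (t i : ℝ) < T → Atomless μ (𝓕 (t i))) :
    convexHull ℝ (payoffFunctions 𝓕 Y Pθ (range t))
      ⊆ closure (payoffFunctions 𝓕 Y Pθ (range t)) := by
  have hcomb : ∀ f₁ ∈ payoffFunctions 𝓕 Y Pθ (range t),
      ∀ f₂ ∈ payoffFunctions 𝓕 Y Pθ (range t), ∀ a b : ℝ, 0 ≤ a → 0 ≤ b → a + b = 1 →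
      a • f₁ + b • f₂ ∈ closure (payoffFunctions 𝓕 Y Pθ (range t)) := by
    intro f₁ hf₁ f₂ hf₂ a b ha hb hab
    -- For `r = 0` the only date is `T`, where atoms are allowed, but then there is only one
    -- stopping time.
    obtain rfl | hr := Nat.eq_zero_or_pos r
    · obtain ⟨τ₁, hτ₁, hf₁'⟩ := hf₁
      obtain ⟨τ₂, hτ₂, hf₂'⟩ := hf₂
      have hτ : τ₁ = τ₂ := by
        ext1 ω
        obtain ⟨i, hi⟩ := hτ₁.2 ω
        obtain ⟨j, hj⟩ := hτ₂.2 ω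
        rw [← hi, ← hj, Fin.fin_one_eq_zero i, Fin.fin_one_eq_zero j]
      have hf : f₁ = f₂ := by
        ext θ
        rw [hf₁', hf₂', hτ]
      rw [hf, ← add_smul, hab, one_smul]
      exact subset_closure ⟨τ₂, hτ₂, hf₂'⟩
    · have h0 : (t 0 : ℝ) < T :=
        lt_of_lt_of_eq (ht (Fin.pos_iff_ne_zero.2 (by simpa [Fin.ext_iff] using hr.ne'))) htT
      exact add_smul_mem_closure_payoffFunctions hY habs hC hdens ht (hatom 0 h0) hf₁ hf₂ ha hb hab
  -- Two-point mixtures suffice: by continuity they extend to the closure, which is therefore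
  -- convex.
  refine convexHull_min subset_closure fun f₁ hf₁ f₂ hf₂ a b ha hb hab => ?_
  have := map_mem_closure₂ (f := fun f₁ f₂ : C(S, ℝ) => a • f₁ + b • f₂) (by fun_prop) hf₁ hf₂
    fun f₁ hf₁ f₂ hf₂ => hcomb f₁ hf₁ f₂ hf₂ a b ha hb hab
  rwa [closure_closure] at this

end PayoffFunctions

end Ambiguity

/-! ### The minimax identity

For `α` below the right-hand side, left continuity of the dual function gives, for every `𝒬`, a
stopping time `τ` and some `X` of certainty equivalent above `α` with `∫ X d𝒬 < 𝔼^𝒬[Y_τ]`.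
Separation in `C(S)` makes one convex combination of payoffs dominate one convex combination of such
`X` pointwise, and pasting on the atomless `𝓕 (t 0)` approximates the former by a single stopping
time. The properties of `v` enter only through the continuity of the dual function. -/

theorem theorem2
    {Ω : Type*} {mΩ : MeasurableSpace Ω}
    {S : Type*} [MetricSpace S] [CompactSpace S] [MeasurableSpace S] [BorelSpace S]
    (T : ℝ) (hT : 0 < T)
    (μ : Measure Ω) [IsProbabilityMeasure μ]
    (𝓕 : Filtration (Icc (0 : ℝ) T) mΩ) (h𝓕 : Ambiguity.UsualConditions 𝓕 μ)
    (Y : Icc (0 : ℝ) T → Ω → ℝ) (hY : Adapted 𝓕 Y)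
    (hYrc : ∀ ω t, ContinuousWithinAt (fun s => Y s ω) (Ici t) t)
    (P₀ : ProbabilityMeasure S)
    (Pθ : Kernel S Ω) [IsMarkovKernel Pθ]
    (v : ℝ → EReal) (hv : Ambiguity.IsAmbiguityAttitude v)
    (habs : ∀ θ, Pθ θ ≪ μ)
    (hint : ∃ C : ℝ≥0, ∀ θ, ∫⁻ ω, Ambiguity.runningSup Y ω ∂(Pθ θ) < C)
    (hdens : Tendsto (Ambiguity.densityModulus μ Pθ Y) (𝓝[>] 0) (𝓝 0))
    (hcont : Ambiguity.ContinuityAssumption v P₀ Pθ 𝓕 Y)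
    (r : ℕ) (t : Fin (r + 1) → Icc (0 : ℝ) T) (ht : StrictMono t)
    (ht0 : 0 < (t 0 : ℝ)) (htT : (t (Fin.last r) : ℝ) = T)
    (hatom : ∀ i, (t i : ℝ) < T → Ambiguity.Atomless μ (𝓕 (t i))) :
    (⨆ τ ∈ Ambiguity.stoppingTimesIn 𝓕 (range t), ⨅ Q : ProbabilityMeasure S,
        Ambiguity.objective v P₀ Pθ Y τ Q)
      = (⨅ Q : ProbabilityMeasure S, ⨆ τ ∈ Ambiguity.stoppingTimesIn 𝓕 (range t),
        Ambiguity.objective v P₀ Pθ Y τ Q) := by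
  obtain ⟨C, hC⟩ := hint
  have hS : Nonempty S := P₀.nonempty
  refine le_antisymm (iSup₂_le fun τ hτ => iInf_mono fun Q => le_iSup₂_of_le τ hτ le_rfl) ?_
  refine le_of_forall_lt fun α hα => ?_
  -- The final infimum over `𝒬` preserves only the weak bound `α' ≤ ·`, so a gap above `α` is kept.
  obtain ⟨α', hαα', hα'⟩ := exists_between hα
  refine hαα'.trans_le ?_
  have hint : ∀ τ ∈ Ambiguity.stoppingTimesIn 𝓕 (range t), ∀ θ,
      Integrable (fun ω => Y (τ ω) ω) (Pθ θ) := fun τ hτ θ =>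
    Ambiguity.integrable_of_enorm_le_runningSup (Ambiguity.measurable_stopped hY hτ)
      (Ambiguity.enorm_stopped_le_runningSup Y τ) (hC θ)
  have hobj : ∀ τ ∈ Ambiguity.stoppingTimesIn 𝓕 (range t), ∀ Q,
      Ambiguity.objective v P₀ Pθ Y τ Q
        = Ambiguity.dualR v P₀ Q (∫ θ, ∫ ω, Y (τ ω) ω ∂(Pθ θ) ∂(Q : Measure S)) := fun τ hτ Q => by
    rw [Ambiguity.objective,
      Ambiguity.integral_scenarioMeasure (Z := fun ω => Y (τ ω) ω)
        (Ambiguity.measurable_stopped hY hτ) (Ambiguity.enorm_stopped_le_runningSup Y τ) hC]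
  let K := Ambiguity.payoffFunctions 𝓕 Y Pθ (range t)
  let A : Set C(S, ℝ) := {X | α' < Ambiguity.certaintyEquivalent v P₀ X}
  have hB : ∀ Q : ProbabilityMeasure S, ∃ f ∈ K, ∃ X ∈ A,
      ∫ θ, X θ ∂(Q : Measure S) < ∫ θ, f θ ∂(Q : Measure S) := by
    intro Q
    have hQ := hα'.trans_le (iInf_le _ Q)
    simp only [lt_iSup_iff] at hQ
    obtain ⟨τ, hτ, hlt⟩ := hQ
    rw [hobj τ hτ] at hlt
    let f : C(S, ℝ) := ⟨fun θ => ∫ ω, Y (τ ω) ω ∂(Pθ θ),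
      Ambiguity.continuous_integral_kernel habs hdens (hint τ hτ)
        (Ambiguity.enorm_stopped_le_runningSup Y τ)⟩
    have hcat : ContinuousAt (Ambiguity.dualR v P₀ Q) (∫ θ, f θ ∂(Q : Measure S)) := by
      rcases hcont with h | ⟨h, hpos⟩
      · exact (h Q).continuousAt
      · refine (h Q).continuousAt (Ioi_mem_nhds ?_)
        simpa using Ambiguity.integral_lt_integral_of_forall_lt Q (X := 0) (Z := f)
          fun θ => hpos τ hτ.1 θ
    obtain ⟨X, hX, hXlt⟩ := Ambiguity.exists_lt_certaintyEquivalent hcat hlt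
    exact ⟨f, ⟨τ, hτ, fun θ => rfl⟩, X, hX, hXlt⟩
  obtain ⟨f, hf, X, hX, hXf⟩ := Ambiguity.exists_mem_convexHull_forall_lt hB
  have hgpos : ∀ θ, 0 < (f - X) θ := fun θ => sub_pos.2 (hXf θ)
  have hfK := Ambiguity.convexHull_payoffFunctions_subset hY habs hC hdens ht htT hatom hf
  -- By compactness `f - X` has a positive minimum, which is the tolerance for replacing `f` by the
  -- payoff of one stopping time.
  obtain ⟨θ₀, -, hθ₀⟩ := isCompact_univ.exists_isMinOn univ_nonempty
    (f - X).continuous.continuousOn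
  obtain ⟨f', ⟨τ, hτ, hf'⟩, hdist⟩ := Metric.mem_closure_iff.1 hfK _ (hgpos θ₀)
  have hXf' : ∀ θ, X θ < f' θ := fun θ => by
    have h1 : (f - X) θ₀ ≤ (f - X) θ := hθ₀ (mem_univ θ)
    have h2 := (ContinuousMap.dist_lt_iff (hgpos θ₀)).1 hdist θ
    rw [Real.dist_eq, abs_lt] at h2
    simp only [ContinuousMap.sub_apply] at h1 h2
    linarith
  refine le_iSup₂_of_le τ hτ (le_iInf fun Q => ?_)
  -- `τ` is already fixed; only `X'` varies with `Q`, as the supremum in the dual function permits.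
  obtain ⟨X', hX', hle⟩ := Ambiguity.exists_mem_integral_le_of_mem_convexHull hX Q
  rw [hobj τ hτ]
  refine hX'.le.trans (Ambiguity.certaintyEquivalent_le_dualR (hle.trans ?_))
  simpa only [hf'] using (Ambiguity.integral_lt_integral_of_forall_lt Q hXf').le
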